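/- Let $M$ be a connected smooth manifold (Hausdorff, second countable) of dimension $n>1$. Let $g$ be a smooth pseudo-Riemannian metric on $M$ with Levi-Civita connection $\nabla$, and let $(\phi,\xi,\eta)$ be an almost paracontact structure on $M$, that is, a smooth $(1,1)$-tensor field $\phi$, a smooth vector field $\xi$ and a smooth $1$-form $\eta$ with $$\phi^2=I-\eta\otimes\xi,\qquad \eta(\xi)=1,\qquad \phi\xi=0,\qquad \eta\circ\phi=0 .$$ Suppose that $(\phi,\xi,\eta,g)$ is K-paracontact, that is, for all smooth vector fields $X,Y$ on $M$: 1. $g(\phi X,\phi Y)=-g(X,Y)+\eta(X)\eta(Y)$ (compatibility); 2. $d\eta(X,Y)=g(X,\phi Y)$, where $2\,d\eta(X,Y)=X(\eta(Y))-Y(\eta(X))-\eta([X,Y])$ (paracontact metric structure); 3. $h=\tfrac12\mathfrak{L}_\xi\phi=0$, that is, $[\xi,\phi X]=\phi[\xi,X]$. Let $r$ be the scalar curvature of $g$: with $R(X,Y)=[\nabla_X,\nabla_Y]-\nabla_{[X,Y]}$, it is the $g$-trace of the Ricci tensor $S(Y,Z)=\operatorname{tr}(X\mapsto R(X,Y)Z)$.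 Suppose that $g$ is a $\delta$-almost gradient Yamabe soliton with potential function $u$, that is, $u$ and $\lambda$ are smooth real functions on $M$, $\delta$ is a nowhere vanishing real function on $M$, and $$\frac{\delta}{2}\,\mathfrak{L}_{\nabla u}\,g=(r-\lambda)\,g ,$$ where $\nabla u$ is the $g$-gradient of $u$. Then the function $$\frac{r-\lambda}{\delta}-u$$ is constant on $M$. -/

import Mathlib

open Bundle FiberBundle VectorField
open scoped Manifold ContDiff

noncomputable section

namespace Paracontact

/-- The coordinate model of an `n`-dimensional manifold. -/
abbrev E (n : ℕ) : Type := EuclideanSpace ℝ (Fin n)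

instance tangentFiniteDimensional {n : ℕ} {M : Type*} [TopologicalSpace M] [ChartedSpace (E n) M]
    (x : M) : FiniteDimensional ℝ (TangentSpace (𝓡 n) x) :=
  inferInstanceAs (FiniteDimensional ℝ (E n))

instance tangentT2Space {n : ℕ} {M : Type*} [TopologicalSpace M] [ChartedSpace (E n) M]
    (x : M) : T2Space (TangentSpace (𝓡 n) x) :=
  inferInstanceAs (T2Space (E n))

/-- The directional derivative `X f` of a function `f` along a vector field `X`, at `x`. -/
def dirDeriv {n : ℕ} {M : Type*} [TopologicalSpace M] [ChartedSpace (E n) M]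
    (X : Π x : M, TangentSpace (𝓡 n) x) (f : M → ℝ) (x : M) : ℝ :=
  mvfderiv (𝓡 n) f x (X x)

/-- `X` is a smooth vector field on `M`, i.e. `X ∈ χ(M)`. -/
def IsSmoothField {n : ℕ} {M : Type*} [TopologicalSpace M] [ChartedSpace (E n) M]
    [IsManifold (𝓡 n) ∞ M] (X : Π x : M, TangentSpace (𝓡 n) x) : Prop :=
  ContMDiff (𝓡 n) (𝓡 n).tangent ∞ (fun x ↦ (⟨x, X x⟩ : TangentBundle (𝓡 n) M))

/-- `X` is a vector field that is differentiable at `x`. -/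
abbrev DiffFieldAt {n : ℕ} {M : Type*} [TopologicalSpace M] [ChartedSpace (E n) M]
    [IsManifold (𝓡 n) ∞ M] (X : Π x : M, TangentSpace (𝓡 n) x) (x : M) : Prop :=
  MDifferentiableAt (𝓡 n) (𝓡 n).tangent (fun y ↦ (⟨y, X y⟩ : TangentBundle (𝓡 n) M)) x

/-- A smooth pseudo-Riemannian metric: a smooth field of symmetric non-degenerate bilinear forms on
the tangent spaces, of any signature. -/
structure PseudoRiemannianMetric (n : ℕ) (M : Type*) [TopologicalSpace M]
    [ChartedSpace (E n) M] [IsManifold (𝓡 n) ∞ M] where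
  /-- The bilinear form on the tangent space at `x`. -/
  val (x : M) : TangentSpace (𝓡 n) x →L[ℝ] TangentSpace (𝓡 n) x →L[ℝ] ℝ
  symm (x : M) (v w : TangentSpace (𝓡 n) x) : val x v w = val x w v
  nondegenerate (x : M) (v : TangentSpace (𝓡 n) x) (hv : ∀ w, val x v w = 0) : v = 0
  contMDiff : ContMDiff (𝓡 n) ((𝓡 n).prod 𝓘(ℝ, E n →L[ℝ] E n →L[ℝ] ℝ)) ∞
    (fun x ↦ TotalSpace.mk' (E n →L[ℝ] E n →L[ℝ] ℝ)
      (E := fun x : M ↦ TangentSpace (𝓡 n) x →L[ℝ] TangentSpace (𝓡 n) x →L[ℝ] ℝ) x (val x))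

namespace PseudoRiemannianMetric

variable {n : ℕ} {M : Type*} [TopologicalSpace M] [ChartedSpace (E n) M] [IsManifold (𝓡 n) ∞ M]

/-- The musical isomorphism `v ↦ g(v, ·)`. -/
def flat (g : PseudoRiemannianMetric n M) (x : M) :
    TangentSpace (𝓡 n) x ≃ₗ[ℝ] (TangentSpace (𝓡 n) x →L[ℝ] ℝ) :=
  LinearEquiv.ofInjectiveOfFinrankEq (g.val x : TangentSpace (𝓡 n) x →ₗ[ℝ] _)
    (by
      rw [injective_iff_map_eq_zero]
      intro v hv
      exact g.nondegenerate x v fun w ↦ by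
        simpa using congrArg (fun α : TangentSpace (𝓡 n) x →L[ℝ] ℝ ↦ α w) hv)
    (by
      rw [← (LinearMap.toContinuousLinearMap :
        (TangentSpace (𝓡 n) x →ₗ[ℝ] ℝ) ≃ₗ[ℝ] _).finrank_eq]
      exact (Subspace.dual_finrank_eq).symm)

/-- The inverse musical isomorphism: `g.sharp x α` is the vector with `g (g.sharp x α, ·) = α`. -/
def sharp (g : PseudoRiemannianMetric n M) (x : M) :
    (TangentSpace (𝓡 n) x →L[ℝ] ℝ) ≃ₗ[ℝ] TangentSpace (𝓡 n) x :=
  (g.flat x).symm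

theorem val_sharp (g : PseudoRiemannianMetric n M) (x : M) (α : TangentSpace (𝓡 n) x →L[ℝ] ℝ)
    (w : TangentSpace (𝓡 n) x) : g.val x (g.sharp x α) w = α w := by
  have h : g.flat x (g.sharp x α) = α := (g.flat x).apply_symm_apply α
  exact congrArg (fun β : TangentSpace (𝓡 n) x →L[ℝ] ℝ ↦ β w) h

/-- The function `g(X, Y)`. -/
def pair (g : PseudoRiemannianMetric n M) (X Y : Π x : M, TangentSpace (𝓡 n) x) (x : M) : ℝ :=
  g.val x (X x) (Y x)

theorem pair_comm (g : PseudoRiemannianMetric n M) (X Y : Π x : M, TangentSpace (𝓡 n) x) :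
    g.pair X Y = g.pair Y X := funext fun x ↦ g.symm x _ _

theorem mdifferentiableAt_pair (g : PseudoRiemannianMetric n M)
    {X Y : Π x : M, TangentSpace (𝓡 n) x} {x : M}
    (hX : DiffFieldAt X x) (hY : DiffFieldAt Y x) : MDifferentiableAt (𝓡 n) 𝓘(ℝ) (g.pair X Y) x := by
  have hg := (g.contMDiff x).mdifferentiableAt (by simp)
  have h := MDifferentiableAt.clm_bundle_apply₂ (F₁ := E n) (F₂ := E n) (F₃ := ℝ)
    (E₁ := fun x : M ↦ TangentSpace (𝓡 n) x) (E₂ := fun x : M ↦ TangentSpace (𝓡 n) x)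
    (E₃ := fun _ : M ↦ ℝ) (b := fun x : M ↦ x) hg hX hY
  have h' := (mdifferentiableAt_totalSpace _ _).1 h
  simpa using! h'.2

/-- The right-hand side of the Koszul formula, which is `2 g(∇_X Y, Z)`. -/
def koszul (g : PseudoRiemannianMetric n M) (X Y Z : Π x : M, TangentSpace (𝓡 n) x)
    (x : M) : ℝ :=
  dirDeriv X (g.pair Y Z) x + dirDeriv Y (g.pair X Z) x - dirDeriv Z (g.pair X Y) x
    + g.pair (mlieBracket (𝓡 n) X Y) Z x - g.pair (mlieBracket (𝓡 n) X Z) Y x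
    - g.pair (mlieBracket (𝓡 n) Y Z) X x

theorem pair_smul_left (g : PseudoRiemannianMetric n M) (f : M → ℝ)
    (X Y : Π x : M, TangentSpace (𝓡 n) x) : g.pair (f • X) Y = fun x ↦ f x * g.pair X Y x := by
  ext x; simp [pair]

theorem pair_smul_right (g : PseudoRiemannianMetric n M) (f : M → ℝ)
    (X Y : Π x : M, TangentSpace (𝓡 n) x) : g.pair X (f • Y) = fun x ↦ f x * g.pair X Y x := by
  ext x; simp [pair]

theorem pair_add_left (g : PseudoRiemannianMetric n M)
    (X X' Y : Π x : M, TangentSpace (𝓡 n) x) :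
    g.pair (X + X') Y = fun x ↦ g.pair X Y x + g.pair X' Y x := by
  ext x; simp [pair]

theorem pair_add_right (g : PseudoRiemannianMetric n M)
    (X Y Y' : Π x : M, TangentSpace (𝓡 n) x) :
    g.pair X (Y + Y') = fun x ↦ g.pair X Y x + g.pair X Y' x := by
  ext x; simp [pair]

theorem koszul_tensorial_left (g : PseudoRiemannianMetric n M)
    {Y Z : Π x : M, TangentSpace (𝓡 n) x} {x : M}
    (hY : DiffFieldAt Y x) (hZ : DiffFieldAt Z x) :
    TensorialAt (𝓡 n) (E n) (fun X ↦ g.koszul X Y Z x) x where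
  smul {f X} hf hX := by
    have h1 := mlieBracket_smul_left (W := Y) hf hX
    have h2 := mlieBracket_smul_left (W := Z) hf hX
    simp only [koszul, dirDeriv, pair_smul_left, pair_smul_right,
      mvfderiv_fun_mul hf (g.mdifferentiableAt_pair hX hZ),
      mvfderiv_fun_mul hf (g.mdifferentiableAt_pair hX hY)]
    simp [pair, h1, h2, g.symm x (X x)]
    ring
  add {X X'} hX hX' := by
    have h1 := mlieBracket_add_left (W := Y) hX hX'
    have h2 := mlieBracket_add_left (W := Z) hX hX'
    simp only [koszul, dirDeriv, pair_add_left, pair_add_right,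
      mvfderiv_fun_add (g.mdifferentiableAt_pair hX hZ) (g.mdifferentiableAt_pair hX' hZ),
      mvfderiv_fun_add (g.mdifferentiableAt_pair hX hY) (g.mdifferentiableAt_pair hX' hY)]
    simp [pair, h1, h2]
    ring

theorem koszul_tensorial_right (g : PseudoRiemannianMetric n M)
    {X Y : Π x : M, TangentSpace (𝓡 n) x} {x : M}
    (hX : DiffFieldAt X x) (hY : DiffFieldAt Y x) :
    TensorialAt (𝓡 n) (E n) (fun Z ↦ g.koszul X Y Z x) x where
  smul {f Z} hf hZ := by
    have h1 := mlieBracket_smul_right (V := X) hf hZ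
    have h2 := mlieBracket_smul_right (V := Y) hf hZ
    simp only [koszul, dirDeriv, pair_smul_right,
      mvfderiv_fun_mul hf (g.mdifferentiableAt_pair hY hZ),
      mvfderiv_fun_mul hf (g.mdifferentiableAt_pair hX hZ)]
    simp [pair, h1, h2, g.symm x (Z x)]
    ring
  add {Z Z'} hZ hZ' := by
    have h1 := mlieBracket_add_right (V := X) hZ hZ'
    have h2 := mlieBracket_add_right (V := Y) hZ hZ'
    simp only [koszul, dirDeriv, pair_add_right,
      mvfderiv_fun_add (g.mdifferentiableAt_pair hY hZ) (g.mdifferentiableAt_pair hY hZ'),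
      mvfderiv_fun_add (g.mdifferentiableAt_pair hX hZ) (g.mdifferentiableAt_pair hX hZ')]
    simp [pair, h1, h2]
    ring

/-- For `Y` differentiable at `x`, the bilinear form `(v, w) ↦ 2 g(∇_v Y, w)` on the tangent space
at `x` that the Koszul formula determines. -/
def koszulForm (g : PseudoRiemannianMetric n M) (Y : Π x : M, TangentSpace (𝓡 n) x) (x : M)
    (hY : DiffFieldAt Y x) : TangentSpace (𝓡 n) x →L[ℝ] TangentSpace (𝓡 n) x →L[ℝ] ℝ :=
  TensorialAt.mkHom₂ (I := 𝓡 n) (F := E n) (F' := E n) (V := fun x : M ↦ TangentSpace (𝓡 n) x)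
    (V' := fun x : M ↦ TangentSpace (𝓡 n) x)
    (fun X Z ↦ g.koszul X Y Z x) x
    (fun _ hZ ↦ g.koszul_tensorial_left hY hZ) (fun _ hX ↦ g.koszul_tensorial_right hX hY)

theorem koszulForm_apply (g : PseudoRiemannianMetric n M)
    {X Y Z : Π x : M, TangentSpace (𝓡 n) x} {x : M}
    (hX : DiffFieldAt X x) (hY : DiffFieldAt Y x) (hZ : DiffFieldAt Z x) :
    g.koszulForm Y x hY (X x) (Z x) = g.koszul X Y Z x :=
  TensorialAt.mkHom₂_apply _ _ hX hZ

open scoped Classical in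
/-- The operator `Y ↦ (v ↦ ∇_v Y)` of the Levi-Civita connection, determined by the Koszul formula;
its value where `Y` is not differentiable is irrelevant. -/
def leviCivitaFun (g : PseudoRiemannianMetric n M) (Y : Π x : M, TangentSpace (𝓡 n) x) (x : M) :
    TangentSpace (𝓡 n) x →L[ℝ] TangentSpace (𝓡 n) x :=
  if hY : DiffFieldAt Y x then
    (LinearMap.toContinuousLinearMap (g.sharp x : (TangentSpace (𝓡 n) x →L[ℝ] ℝ) →ₗ[ℝ] _)) ∘L
      ((1 / 2 : ℝ) • g.koszulForm Y x hY)
  else 0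

theorem val_leviCivitaFun (g : PseudoRiemannianMetric n M)
    {X Y Z : Π x : M, TangentSpace (𝓡 n) x} {x : M}
    (hX : DiffFieldAt X x) (hY : DiffFieldAt Y x) (hZ : DiffFieldAt Z x) :
    g.val x (g.leviCivitaFun Y x (X x)) (Z x) = g.koszul X Y Z x / 2 := by
  have h : g.leviCivitaFun Y x (X x) = g.sharp x ((1 / 2 : ℝ) • g.koszulForm Y x hY (X x)) := by
    simp [leviCivitaFun, hY]
  rw [h, val_sharp, ← g.koszulForm_apply hX hY hZ]
  simp
  ring

/-- Two tangent vectors with the same products with all (locally defined) vector fields agree. -/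
theorem ext_val (g : PseudoRiemannianMetric n M) {x : M} {v w : TangentSpace (𝓡 n) x}
    (h : ∀ Z : Π x : M, TangentSpace (𝓡 n) x, DiffFieldAt Z x →
      g.val x v (Z x) = g.val x w (Z x)) : v = w := by
  rw [← sub_eq_zero]
  refine g.nondegenerate x _ fun z ↦ ?_
  have := h (extend (E n) z) (mdifferentiableAt_extend ..)
  simp only [extend_apply_self] at this
  simp [this]

/-- The Levi-Civita connection of a pseudo-Riemannian metric. Following the convention for
covariant derivatives, `g.leviCivita Y x (X x)` is `(∇_X Y)(x)`. -/
def leviCivita (g : PseudoRiemannianMetric n M) :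
    CovariantDerivative (𝓡 n) (E n) (fun x : M ↦ TangentSpace (𝓡 n) x) where
  toFun := g.leviCivitaFun
  isCovariantDerivativeOnUniv :=
    { add := by
        intro Y Y' x hY hY' _
        ext1 v
        refine g.ext_val fun Z hZ ↦ ?_
        have hX : DiffFieldAt (extend (E n) v) x := mdifferentiableAt_extend ..
        have e := extend_apply_self (F := E n) v
        have h0 := g.val_leviCivitaFun hX (mdifferentiableAt_add_section hY hY') hZ
        have h1 := g.val_leviCivitaFun hX hY hZ
        have h2 := g.val_leviCivitaFun hX hY' hZ
        rw [e] at h0 h1 h2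
        have b1 := mlieBracket_add_right (V := extend (E n) v) hY hY'
        have b2 := mlieBracket_add_left (W := Z) hY hY'
        rw [h0]
        simp only [_root_.add_apply, map_add]
        rw [h1, h2]
        simp only [koszul, dirDeriv, pair_add_left, pair_add_right,
          mvfderiv_fun_add (g.mdifferentiableAt_pair hY hZ) (g.mdifferentiableAt_pair hY' hZ),
          mvfderiv_fun_add (g.mdifferentiableAt_pair hX hY) (g.mdifferentiableAt_pair hX hY')]
        simp [pair, b1, b2]
        ring
      leibniz := by
        intro Y f x hY hf _
        ext1 v
        refine g.ext_val fun Z hZ ↦ ?_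
        have hX : DiffFieldAt (extend (E n) v) x := mdifferentiableAt_extend ..
        have e := extend_apply_self (F := E n) v
        have h0 := g.val_leviCivitaFun hX (hf.smul_section hY) hZ
        have h1 := g.val_leviCivitaFun hX hY hZ
        rw [e] at h0 h1
        have b1 := mlieBracket_smul_right (V := extend (E n) v) hf hY
        have b2 := mlieBracket_smul_left (W := Z) hf hY
        rw [h0]
        simp only [_root_.add_apply, map_add, _root_.smul_apply,
          map_smul, ContinuousLinearMap.smulRight_apply, smul_eq_mul]
        rw [h1]
        simp only [koszul, dirDeriv, pair_smul_left, pair_smul_right,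
          mvfderiv_fun_mul hf (g.mdifferentiableAt_pair hY hZ),
          mvfderiv_fun_mul hf (g.mdifferentiableAt_pair hX hY)]
        simp [pair, b1, b2, g.symm x v]
        ring }

/-- The Levi-Civita connection is torsion-free: `∇_X Y - ∇_Y X = [X, Y]`. -/
theorem leviCivita_torsion_free (g : PseudoRiemannianMetric n M)
    {X Y : Π x : M, TangentSpace (𝓡 n) x} {x : M} (hX : DiffFieldAt X x) (hY : DiffFieldAt Y x) :
    g.leviCivita Y x (X x) - g.leviCivita X x (Y x) = mlieBracket (𝓡 n) X Y x := by
  refine g.ext_val fun Z hZ ↦ ?_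
  have h1 := g.val_leviCivitaFun hX hY hZ
  have h2 := g.val_leviCivitaFun hY hX hZ
  have b : mlieBracket (𝓡 n) Y X x = -mlieBracket (𝓡 n) X Y x := mlieBracket_swap_apply
  simp only [map_sub, _root_.sub_apply]
  change g.val x (g.leviCivitaFun Y x (X x)) (Z x) - g.val x (g.leviCivitaFun X x (Y x)) (Z x) = _
  rw [h1, h2]
  simp only [koszul, pair_comm g Y X]
  simp [pair, b]
  ring

/-- The Levi-Civita connection is metric: `X (g(Y, Z)) = g(∇_X Y, Z) + g(Y, ∇_X Z)`. -/
theorem leviCivita_metric (g : PseudoRiemannianMetric n M)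
    {X Y Z : Π x : M, TangentSpace (𝓡 n) x} {x : M} (hX : DiffFieldAt X x)
    (hY : DiffFieldAt Y x) (hZ : DiffFieldAt Z x) :
    dirDeriv X (g.pair Y Z) x =
      g.val x (g.leviCivita Y x (X x)) (Z x) + g.val x (Y x) (g.leviCivita Z x (X x)) := by
  have h1 := g.val_leviCivitaFun hX hY hZ
  have h2 := g.val_leviCivitaFun hX hZ hY
  have b : mlieBracket (𝓡 n) Z Y x = -mlieBracket (𝓡 n) Y Z x := mlieBracket_swap_apply
  rw [g.symm x (Y x)]
  change _ = g.val x (g.leviCivitaFun Y x (X x)) (Z x) + g.val x (g.leviCivitaFun Z x (X x)) (Y x)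
  rw [h1, h2]
  simp only [koszul, pair_comm g Z Y]
  simp [pair, b]
  ring

/-- The Riemann curvature `R(X, Y)Z = ∇_X ∇_Y Z - ∇_Y ∇_X Z - ∇_[X, Y] Z` on vector fields. -/
def curvature (g : PseudoRiemannianMetric n M) (X Y Z : Π x : M, TangentSpace (𝓡 n) x) (x : M) :
    TangentSpace (𝓡 n) x :=
  g.leviCivita (fun y ↦ g.leviCivita Z y (Y y)) x (X x)
    - g.leviCivita (fun y ↦ g.leviCivita Z y (X y)) x (Y x)
    - g.leviCivita Z x (mlieBracket (𝓡 n) X Y x)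

/-- The curvature tensor at `x` on tangent vectors: the curvature of vector fields that extend them
smoothly near `x`. -/
def curvatureAt (g : PseudoRiemannianMetric n M) (x : M) (u v w : TangentSpace (𝓡 n) x) :
    TangentSpace (𝓡 n) x :=
  g.curvature (extend (E n) u) (extend (E n) v) (extend (E n) w) x

/-- The basis of the tangent space at `x` given by the standard basis of the model space. -/
def tangentBasis (x : M) : Module.Basis (Fin n) ℝ (TangentSpace (𝓡 n) x) :=
  (EuclideanSpace.basisFun (Fin n) ℝ).toBasis

/-- The Ricci tensor `S(v, w)`, i.e. the trace of `u ↦ R(u, v)w`. -/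
def ricci (g : PseudoRiemannianMetric n M) (x : M) (v w : TangentSpace (𝓡 n) x) : ℝ :=
  ∑ i, (tangentBasis x).coord i (g.curvatureAt x (tangentBasis x i) v w)

/-- The scalar curvature `r`, i.e. the trace of the Ricci tensor with respect to `g`. The vectors
`g.sharp x (coord i)` form the basis that is `g`-dual to `tangentBasis x`. -/
def scalarCurvature (g : PseudoRiemannianMetric n M) (x : M) : ℝ :=
  ∑ i, g.ricci x (tangentBasis x i)
    (g.sharp x (LinearMap.toContinuousLinearMap ((tangentBasis x).coord i)))

/-- The gradient `∇u`. -/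
def gradient (g : PseudoRiemannianMetric n M) (u : M → ℝ) (x : M) : TangentSpace (𝓡 n) x :=
  g.sharp x (mvfderiv (𝓡 n) u x)

/-- The Lie derivative of the metric:
`(𝔏_Z g)(X, Y) = Z (g(X, Y)) - g([Z, X], Y) - g(X, [Z, Y])`. -/
def lieDeriv (g : PseudoRiemannianMetric n M) (Z X Y : Π x : M, TangentSpace (𝓡 n) x)
    (x : M) : ℝ :=
  dirDeriv Z (g.pair X Y) x - g.pair (mlieBracket (𝓡 n) Z X) Y x
    - g.pair X (mlieBracket (𝓡 n) Z Y) x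

/-- `(g, Z, δ, l)` is a `δ`-almost Yamabe soliton: `Z` is a smooth vector field, `l` (the soliton
function `λ`) is smooth, `δ` vanishes nowhere, and `(δ / 2) 𝔏_Z g = (r - λ) g`. -/
structure IsAlmostYamabeSoliton (g : PseudoRiemannianMetric n M)
    (Z : Π x : M, TangentSpace (𝓡 n) x) (δ l : M → ℝ) : Prop where
  smooth_field : IsSmoothField Z
  smooth_l : ContMDiff (𝓡 n) 𝓘(ℝ) ∞ l
  delta_ne_zero : ∀ x, δ x ≠ 0
  soliton : ∀ X Y : Π x : M, TangentSpace (𝓡 n) x, IsSmoothField X → IsSmoothField Y → ∀ x,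
    δ x / 2 * g.lieDeriv Z X Y x = (g.scalarCurvature x - l x) * g.pair X Y x

/-- `(g, u, δ, l)` is a `δ`-almost gradient Yamabe soliton with potential function `u`. -/
structure IsAlmostGradientYamabeSoliton (g : PseudoRiemannianMetric n M) (u δ l : M → ℝ) :
    Prop where
  smooth_potential : ContMDiff (𝓡 n) 𝓘(ℝ) ∞ u
  soliton : g.IsAlmostYamabeSoliton (g.gradient u) δ l

end PseudoRiemannianMetric

/-- An almost paracontact structure `(φ, ξ, η)`: a smooth (1,1)-tensor field, a smooth vector field
and a smooth 1-form with `φ² = I - η ⊗ ξ`, `η(ξ) = 1`, `φ ξ = 0` and `η ∘ φ = 0`. -/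
structure AlmostParacontactStructure (n : ℕ) (M : Type*) [TopologicalSpace M]
    [ChartedSpace (E n) M] [IsManifold (𝓡 n) ∞ M] where
  /-- The (1,1)-tensor field `φ`. -/
  φ (x : M) : TangentSpace (𝓡 n) x →L[ℝ] TangentSpace (𝓡 n) x
  /-- The Reeb vector field. -/
  ξ (x : M) : TangentSpace (𝓡 n) x
  /-- The 1-form `η`. -/
  η (x : M) : TangentSpace (𝓡 n) x →L[ℝ] ℝ
  smooth_φ : ContMDiff (𝓡 n) ((𝓡 n).prod 𝓘(ℝ, E n →L[ℝ] E n)) ∞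
    (fun x ↦ TotalSpace.mk' (E n →L[ℝ] E n)
      (E := fun x : M ↦ TangentSpace (𝓡 n) x →L[ℝ] TangentSpace (𝓡 n) x) x (φ x))
  smooth_ξ : IsSmoothField ξ
  smooth_η : ContMDiff (𝓡 n) ((𝓡 n).prod 𝓘(ℝ, E n →L[ℝ] ℝ)) ∞
    (fun x ↦ TotalSpace.mk' (E n →L[ℝ] ℝ)
      (E := fun x : M ↦ TangentSpace (𝓡 n) x →L[ℝ] ℝ) x (η x))
  φ_sq (x : M) (v : TangentSpace (𝓡 n) x) : φ x (φ x v) = v - η x v • ξ x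
  η_ξ (x : M) : η x (ξ x) = 1
  φ_ξ (x : M) : φ x (ξ x) = 0
  η_φ (x : M) (v : TangentSpace (𝓡 n) x) : η x (φ x v) = 0

namespace AlmostParacontactStructure

variable {n : ℕ} {M : Type*} [TopologicalSpace M] [ChartedSpace (E n) M] [IsManifold (𝓡 n) ∞ M]

/-- The function `η(X)`. -/
def etaApply (P : AlmostParacontactStructure n M) (X : Π x : M, TangentSpace (𝓡 n) x) (x : M) :
    ℝ :=
  P.η x (X x)

/-- The vector field `φ X`. -/
def phiApply (P : AlmostParacontactStructure n M) (X : Π x : M, TangentSpace (𝓡 n) x) (x : M) :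
    TangentSpace (𝓡 n) x :=
  P.φ x (X x)

/-- The exterior derivative of `η`, with the normalization
`2 dη(X, Y) = X(η(Y)) - Y(η(X)) - η([X, Y])` of paracontact geometry. -/
def dEta (P : AlmostParacontactStructure n M) (X Y : Π x : M, TangentSpace (𝓡 n) x) (x : M) : ℝ :=
  (dirDeriv X (P.etaApply Y) x - dirDeriv Y (P.etaApply X) x
    - P.etaApply (mlieBracket (𝓡 n) X Y) x) / 2

/-- The operator `h = (1/2) 𝔏_ξ φ`, i.e. `h X = (1/2) ([ξ, φ X] - φ [ξ, X])`. -/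
def h (P : AlmostParacontactStructure n M) (X : Π x : M, TangentSpace (𝓡 n) x) (x : M) :
    TangentSpace (𝓡 n) x :=
  (1 / 2 : ℝ) • (mlieBracket (𝓡 n) P.ξ (P.phiApply X) x
    - P.φ x (mlieBracket (𝓡 n) P.ξ X x))

/-- `(φ, ξ, η, g)` is a paracontact metric structure: `g` is compatible with `(φ, ξ, η)` and
`dη` is the fundamental 2-form `Φ(X, Y) = g(X, φ Y)`. -/
structure IsParacontactMetric (P : AlmostParacontactStructure n M)
    (g : PseudoRiemannianMetric n M) : Prop where
  compatible : ∀ (x : M) (v w : TangentSpace (𝓡 n) x),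
    g.val x (P.φ x v) (P.φ x w) = - g.val x v w + P.η x v * P.η x w
  contact : ∀ X Y : Π x : M, TangentSpace (𝓡 n) x, IsSmoothField X → IsSmoothField Y → ∀ x,
    P.dEta X Y x = g.pair X (P.phiApply Y) x

/-- `(φ, ξ, η, g)` is a K-paracontact structure: a paracontact metric structure with `h = 0`. -/
structure IsKParacontact (P : AlmostParacontactStructure n M)
    (g : PseudoRiemannianMetric n M) : Prop extends P.IsParacontactMetric g where
  h_eq_zero : ∀ X : Π x : M, TangentSpace (𝓡 n) x, IsSmoothField X → ∀ x, P.h X x = 0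

end AlmostParacontactStructure

end Paracontact

end

/-! ### Calculus of functions and vector fields on the manifold. -/

namespace Paracontact

variable {n : ℕ} {M : Type*} [TopologicalSpace M] [ChartedSpace (E n) M]

variable {X Y Z : Π x : M, TangentSpace (𝓡 n) x} {f f' : M → ℝ} {x : M}

/-! Put `f = (r - λ)/δ`; the soliton equation says `𝔏_{∇u} g = 2 f g`, and nothing else about the
curvature is needed. A K-paracontact metric is determined by `η`, `dη` and `φ`, all preserved by
`ξ`, so `ξ` is Killing (`dirDeriv_ξ_pair`) and `[ξ, ∇u]` is the gradient of `ξu`. Evaluating the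
soliton equation on `(ξ, X)` then gives `X(ξu) = f η(X) - (φX)u` (`dirDeriv_dirDeriv_ξ`).

With `X = ξ` this reads `ξ(ξu) = f`. Replacing `X` by `φX` and differentiating along `ξ`, which
commutes with `φ`, gives `(φX)f = (φX)u` (`dirDeriv_phiApply`). So `F = f - u` has `dF = (ξF) η`.
Since `ker η` is maximally non-integrable, `F` is killed by brackets of fields in `ker η`, which
forces `ξF = 0` once `n > 1` (`dirDeriv_ξ_eq_zero`). Hence `dF = 0`, and connectedness finishes. -/

theorem dirDeriv_mul (hf : ContMDiff (𝓡 n) 𝓘(ℝ) ∞ f) (hf' : ContMDiff (𝓡 n) 𝓘(ℝ) ∞ f') :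
    dirDeriv X (f * f') x = f x * dirDeriv X f' x + f' x * dirDeriv X f x := by
  simp [dirDeriv, mvfderiv_mul ((hf x).mdifferentiableAt (by simp))
    ((hf' x).mdifferentiableAt (by simp))]

theorem dirDeriv_add (hf : ContMDiff (𝓡 n) 𝓘(ℝ) ∞ f) (hf' : ContMDiff (𝓡 n) 𝓘(ℝ) ∞ f') :
    dirDeriv X (f + f') x = dirDeriv X f x + dirDeriv X f' x := by
  simp [dirDeriv, mvfderiv_add ((hf x).mdifferentiableAt (by simp))
    ((hf' x).mdifferentiableAt (by simp))]

theorem dirDeriv_sub (hf : ContMDiff (𝓡 n) 𝓘(ℝ) ∞ f) (hf' : ContMDiff (𝓡 n) 𝓘(ℝ) ∞ f') :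
    dirDeriv X (f - f') x = dirDeriv X f x - dirDeriv X f' x := by
  simp [dirDeriv, mvfderiv_sub ((hf x).mdifferentiableAt (by simp))
    ((hf' x).mdifferentiableAt (by simp))]

theorem dirDeriv_const (c : ℝ) : dirDeriv X (fun _ : M ↦ c) x = 0 := by
  simp [dirDeriv, mvfderiv_const]

/-- A function with vanishing differential on a connected manifold is constant. -/
theorem exists_eq_const_of_mfderiv_eq_zero [PreconnectedSpace M] [Nonempty M] [IsManifold (𝓡 n) ∞ M]
    (hf : MDifferentiable (𝓡 n) 𝓘(ℝ) f) (hf' : ∀ x, mfderiv (𝓡 n) 𝓘(ℝ) f x = 0) :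
    ∃ c, ∀ x, f x = c := by
  have hloc : IsLocallyConstant f := by
    rw [IsLocallyConstant.iff_eventually_eq]
    intro x
    set e := extChartAt (𝓡 n) x
    obtain ⟨r, hr, hball⟩ := Metric.mem_nhds_iff.1 (extChartAt_target_mem_nhds (I := 𝓡 n) x)
    have hsymm : ∀ y ∈ Metric.ball (e x) r, MDifferentiableAt 𝓘(ℝ, E n) (𝓡 n) e.symm y :=
      fun y hy ↦ ((contMDiffOn_extChartAt_symm (I := 𝓡 n) (n := ∞) x).contMDiffAt
        ((isOpen_extChartAt_target (I := 𝓡 n) x).mem_nhds (hball hy))).mdifferentiableAt (by simp)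
    have hcomp : ∀ y ∈ Metric.ball (e x) r, MDifferentiableAt 𝓘(ℝ, E n) 𝓘(ℝ) (f ∘ e.symm) y :=
      fun y hy ↦ (hf _).comp y (hsymm y hy)
    -- A ball in the chart target is connected, so the zero-derivative criterion of the model space
    -- applies to `f` read in the chart.
    have hconst : ∀ y ∈ Metric.ball (e x) r, (f ∘ e.symm) y = (f ∘ e.symm) (e x) := fun y hy ↦
      Metric.isOpen_ball.is_const_of_fderiv_eq_zero (𝕜 := ℝ)
        (convex_ball (e x) r).isPreconnected
        (fun z hz ↦ (hcomp z hz).differentiableAt.differentiableWithinAt)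
        (fun z hz ↦ by
          have := mfderiv_comp z (hf (e.symm z)) (hsymm z hz)
          rw [hf', mfderiv_eq_fderiv] at this
          exact this.trans (ContinuousLinearMap.zero_comp _))
        hy (Metric.mem_ball_self hr)
    filter_upwards [extChartAt_source_mem_nhds (I := 𝓡 n) x,
      (continuousAt_extChartAt (I := 𝓡 n) x).preimage_mem_nhds (Metric.ball_mem_nhds _ hr)]
      with y hy hy'
    have := hconst (e y) hy'
    rwa [Function.comp_apply, Function.comp_apply, extChartAt_to_inv,
      (extChartAt (𝓡 n) x).left_inv hy] at this
  obtain ⟨x₀⟩ := ‹Nonempty M›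
  exact ⟨f x₀, fun x ↦ hloc.apply_eq_of_preconnectedSpace x x₀⟩

variable [IsManifold (𝓡 n) ∞ M]

/-- Every tangent vector is the value of a smooth vector field. -/
theorem exists_isSmoothField_eq [T2Space M] (x : M) (v : TangentSpace (𝓡 n) x) :
    ∃ X : Π x : M, TangentSpace (𝓡 n) x, IsSmoothField X ∧ X x = v := by
  obtain ⟨s, hs, hX⟩ := exists_contMDiffOn_extend (𝓡 n) (E n) (k := ∞) (x₀ := x) v
  obtain ⟨t, hts, ht, hxt⟩ := mem_nhds_iff.1 hs
  obtain ⟨ψ, -, hψ⟩ :=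
    (SmoothBumpFunction.nhds_basis_tsupport (I := 𝓡 n) x).mem_iff.1 (ht.mem_nhds hxt)
  -- The local extension is cut off by a bump function supported where it is smooth and equal to `1`
  -- at `x`.
  refine ⟨(ψ : M → ℝ) • extend (E n) v, ?_, ?_⟩
  · exact ContMDiffOn.smul_section_of_tsupport ψ.contMDiff.contMDiffOn ht hψ (hX.mono hts)
  · simp

theorem IsSmoothField.diffFieldAt (hX : IsSmoothField X) (x : M) : DiffFieldAt X x :=
  (hX x).mdifferentiableAt (by simp)

theorem IsSmoothField.smul (hf : ContMDiff (𝓡 n) 𝓘(ℝ) ∞ f) (hX : IsSmoothField X) :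
    IsSmoothField (f • X) :=
  ContMDiff.smul_section hf hX

theorem IsSmoothField.mlieBracket (hX : IsSmoothField X) (hY : IsSmoothField Y) :
    IsSmoothField (mlieBracket (𝓡 n) X Y) := by
  have : IsManifold (𝓡 n) (((⊤ : ℕ∞) : WithTop ℕ∞) + 1) M := by
    simpa using ‹IsManifold (𝓡 n) ∞ M›
  have : IsManifold (𝓡 n) (minSmoothness ℝ 2) M :=
    IsManifold.of_le (n := ∞) (by
      rw [minSmoothness_of_isRCLikeNormedField]
      exact WithTop.coe_le_coe.2 le_top)
  exact ContDiff.mlieBracket_vectorField (m := ⊤) (n := ⊤) hX hY (by simp)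

theorem mlieBracket_leibniz (hX : IsSmoothField X) (hY : IsSmoothField Y) (hZ : IsSmoothField Z) :
    mlieBracket (𝓡 n) X (mlieBracket (𝓡 n) Y Z) x =
      mlieBracket (𝓡 n) (mlieBracket (𝓡 n) X Y) Z x
        + mlieBracket (𝓡 n) Y (mlieBracket (𝓡 n) X Z) x := by
  have h2 : minSmoothness ℝ 2 ≤ ∞ := by
    rw [minSmoothness_of_isRCLikeNormedField]
    exact WithTop.coe_le_coe.2 le_top
  have : IsManifold (𝓡 n) (minSmoothness ℝ 3) M :=
    IsManifold.of_le (n := ∞) (by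
      rw [minSmoothness_of_isRCLikeNormedField]
      exact WithTop.coe_le_coe.2 le_top)
  exact leibniz_identity_mlieBracket_apply ((hX x).of_le h2) ((hY x).of_le h2) ((hZ x).of_le h2)

theorem mlieBracket_smul (hf : ContMDiff (𝓡 n) 𝓘(ℝ) ∞ f) (hY : IsSmoothField Y) :
    mlieBracket (𝓡 n) X (f • Y) = dirDeriv X f • Y + f • mlieBracket (𝓡 n) X Y :=
  funext fun x ↦ mlieBracket_smul_right ((hf x).mdifferentiableAt (by simp)) (hY.diffFieldAt x)

end Paracontact

/-! ### Smoothness and commutators, with `ξ` and `η` turning functions into fields and back. -/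

namespace Paracontact

variable {n : ℕ} {M : Type*} [TopologicalSpace M] [ChartedSpace (E n) M] [IsManifold (𝓡 n) ∞ M]
  {X Y : Π x : M, TangentSpace (𝓡 n) x} {f : M → ℝ} {x : M}
  {g : PseudoRiemannianMetric n M}

namespace AlmostParacontactStructure

variable (P : AlmostParacontactStructure n M)

theorem etaApply_ξ : P.etaApply P.ξ = fun _ ↦ 1 := funext P.η_ξ

theorem etaApply_phiApply : P.etaApply (P.phiApply X) = fun _ ↦ 0 :=
  funext fun x ↦ P.η_φ x (X x)

theorem isSmoothField_phiApply (hX : IsSmoothField X) : IsSmoothField (P.phiApply X) :=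
  ContMDiff.clm_bundle_apply (b := fun x : M ↦ x) P.smooth_φ hX

theorem contMDiff_etaApply (hX : IsSmoothField X) :
    ContMDiff (𝓡 n) 𝓘(ℝ) ∞ (P.etaApply X) := by
  intro x
  have h := ContMDiffAt.clm_bundle_apply (b := fun x : M ↦ x)
    (E₂ := fun _ : M ↦ ℝ) (P.smooth_η x) (hX x)
  simpa using! (contMDiffAt_totalSpace.1 h).2

/-- The derivative of a smooth function along a smooth vector field is smooth. -/
theorem contMDiff_dirDeriv (P : AlmostParacontactStructure n M) (hX : IsSmoothField X)
    (hf : ContMDiff (𝓡 n) 𝓘(ℝ) ∞ f) : ContMDiff (𝓡 n) 𝓘(ℝ) ∞ (dirDeriv X f) := by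
  -- Since `η(ξ) = 1`, applying `η` to `[X, f ξ] = (X f) ξ + f [X, ξ]` isolates `X f` in terms of
  -- smooth data.
  have h : dirDeriv X f = P.etaApply (mlieBracket (𝓡 n) X (f • P.ξ))
      - f * P.etaApply (mlieBracket (𝓡 n) X P.ξ) := by
    ext x
    rw [mlieBracket_smul hf P.smooth_ξ]
    simp [etaApply, P.η_ξ]
  rw [h]
  exact (P.contMDiff_etaApply (hX.mlieBracket (P.smooth_ξ.smul hf))).sub
    (hf.mul (P.contMDiff_etaApply (hX.mlieBracket P.smooth_ξ)))

/-- `[X, Y] f = X (Y f) - Y (X f)`, a consequence of the Jacobi identity for `X`, `Y`, `f ξ`. -/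
theorem dirDeriv_mlieBracket (P : AlmostParacontactStructure n M) (hX : IsSmoothField X)
    (hY : IsSmoothField Y) (hf : ContMDiff (𝓡 n) 𝓘(ℝ) ∞ f) :
    dirDeriv (mlieBracket (𝓡 n) X Y) f x =
      dirDeriv X (dirDeriv Y f) x - dirDeriv Y (dirDeriv X f) x := by
  have hξ := P.smooth_ξ
  have key (A B : Π x : M, TangentSpace (𝓡 n) x) (hA : IsSmoothField A) (hB : IsSmoothField B) :
      mlieBracket (𝓡 n) A (mlieBracket (𝓡 n) B (f • P.ξ)) x =
        dirDeriv A (dirDeriv B f) x • P.ξ x + dirDeriv B f x • mlieBracket (𝓡 n) A P.ξ x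
          + (dirDeriv A f x • mlieBracket (𝓡 n) B P.ξ x
            + f x • mlieBracket (𝓡 n) A (mlieBracket (𝓡 n) B P.ξ) x) := by
    have hBf := P.contMDiff_dirDeriv hB hf
    rw [mlieBracket_smul hf hξ,
      mlieBracket_add_right ((hξ.smul hBf).diffFieldAt x)
        (((hB.mlieBracket hξ).smul hf).diffFieldAt x),
      mlieBracket_smul hBf hξ, mlieBracket_smul hf (hB.mlieBracket hξ)]
    rfl
  -- Subtracting `f` times Jacobi for `ξ` from Jacobi for `f ξ` leaves only multiples of `ξ`, whose
  -- coefficients `η` reads off.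
  have h0 := mlieBracket_leibniz (x := x) hX hY hξ
  have h1 := mlieBracket_leibniz (x := x) hX hY (hξ.smul hf)
  rw [key X Y hX hY, key Y X hY hX, mlieBracket_smul hf hξ, h0] at h1
  have h2 := congrArg (P.η x) h1
  simp only [map_add, map_smul, Pi.add_apply, Pi.smul_apply', smul_eq_mul, P.η_ξ] at h2
  linarith

theorem contMDiff_dEta (hX : IsSmoothField X) (hY : IsSmoothField Y) :
    ContMDiff (𝓡 n) 𝓘(ℝ) ∞ (P.dEta X Y) :=
  (((P.contMDiff_dirDeriv hX (P.contMDiff_etaApply hY)).sub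
    (P.contMDiff_dirDeriv hY (P.contMDiff_etaApply hX))).sub
    (P.contMDiff_etaApply (hX.mlieBracket hY))).div_const 2

/-! ### Invariance of `η` and `dη` under the Reeb flow. -/

namespace IsParacontactMetric

variable {P}

/-- Compatibility at `(ξ, v)` has zero left side because `φ ξ = 0`. -/
theorem val_ξ_left (hP : P.IsParacontactMetric g) (v : TangentSpace (𝓡 n) x) :
    g.val x (P.ξ x) v = P.η x v := by
  have h := hP.compatible x (P.ξ x) v
  rw [P.φ_ξ, P.η_ξ] at h
  simp only [map_zero, _root_.zero_apply] at h
  linarith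

theorem pair_ξ_left (hP : P.IsParacontactMetric g) : g.pair P.ξ X = P.etaApply X :=
  funext fun _ ↦ hP.val_ξ_left _

theorem pair_phiApply_phiApply (hP : P.IsParacontactMetric g) :
    g.pair X (P.phiApply (P.phiApply Y)) x = g.pair X Y x - P.etaApply X x * P.etaApply Y x := by
  simp only [PseudoRiemannianMetric.pair, phiApply, etaApply, P.φ_sq, map_sub, map_smul,
    g.symm x (X x) (P.ξ x), hP.val_ξ_left, smul_eq_mul]
  ring

/-- The contact condition at `(X, φY)` recovers the metric from `η`, `dη` and `φ`, so that its
invariance under `ξ` reduces to theirs. -/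
theorem pair_eq (hP : P.IsParacontactMetric g) (hX : IsSmoothField X) (hY : IsSmoothField Y) :
    g.pair X Y = P.dEta X (P.phiApply Y) + P.etaApply X * P.etaApply Y := by
  ext x
  simp [hP.contact X _ hX (P.isSmoothField_phiApply hY), hP.pair_phiApply_phiApply]

/-- `𝔏_ξ η = 0`. -/
theorem dirDeriv_ξ_etaApply (hP : P.IsParacontactMetric g) (hX : IsSmoothField X) :
    dirDeriv P.ξ (P.etaApply X) = P.etaApply (mlieBracket (𝓡 n) P.ξ X) := by
  ext x
  have h := hP.contact P.ξ X P.smooth_ξ hX x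
  rw [hP.pair_ξ_left, P.etaApply_phiApply, dEta, P.etaApply_ξ, dirDeriv_const] at h
  linarith

/-- `𝔏_ξ dη = 0`. -/
theorem dirDeriv_ξ_dEta (hP : P.IsParacontactMetric g) (hX : IsSmoothField X)
    (hY : IsSmoothField Y) :
    dirDeriv P.ξ (P.dEta X Y) x =
      P.dEta (mlieBracket (𝓡 n) P.ξ X) Y x + P.dEta X (mlieBracket (𝓡 n) P.ξ Y) x := by
  have hξ := P.smooth_ξ
  have hηX := P.contMDiff_etaApply hX
  have hηY := P.contMDiff_etaApply hY
  have hXηY := P.contMDiff_dirDeriv hX hηY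
  have hYηX := P.contMDiff_dirDeriv hY hηX
  have hηXY := P.contMDiff_etaApply (hX.mlieBracket hY)
  -- The definition of `dη` is solved for `X(η(Y))` and then differentiated along `ξ`; the
  -- commutators `b1`, `b2` and the Jacobi identity `j` regroup the terms.
  have e : dirDeriv X (P.etaApply Y) = (fun _ ↦ 2) * P.dEta X Y
      + dirDeriv Y (P.etaApply X) + P.etaApply (mlieBracket (𝓡 n) X Y) := by
    ext x
    simp [dEta]
    ring
  have h := congrArg (fun f ↦ dirDeriv P.ξ f x) e
  have hd := P.contMDiff_dEta hX hY
  have h2d : ContMDiff (𝓡 n) 𝓘(ℝ) ∞ ((fun _ ↦ 2) * P.dEta X Y) := contMDiff_const.mul hd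
  simp only [dirDeriv_add (h2d.add hYηX) hηXY, dirDeriv_add h2d hYηX,
    dirDeriv_mul (f := fun _ : M ↦ 2) contMDiff_const hd, dirDeriv_const,
    hP.dirDeriv_ξ_etaApply (hX.mlieBracket hY)] at h
  have b1 := P.dirDeriv_mlieBracket (x := x) hξ hX hηY
  have b2 := P.dirDeriv_mlieBracket (x := x) hξ hY hηX
  rw [hP.dirDeriv_ξ_etaApply hY] at b1
  rw [hP.dirDeriv_ξ_etaApply hX] at b2
  have j : P.etaApply (mlieBracket (𝓡 n) P.ξ (mlieBracket (𝓡 n) X Y)) x =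
      P.etaApply (mlieBracket (𝓡 n) (mlieBracket (𝓡 n) P.ξ X) Y) x
        + P.etaApply (mlieBracket (𝓡 n) X (mlieBracket (𝓡 n) P.ξ Y)) x := by
    simp only [etaApply, mlieBracket_leibniz hξ hX hY, map_add]
  simp only [dEta]
  linarith

end IsParacontactMetric

/-! ### The Killing property of `ξ` and non-integrability of `ker η`. -/

namespace IsKParacontact

variable {P}

theorem mlieBracket_ξ_phiApply (hP : P.IsKParacontact g) (hX : IsSmoothField X) :
    mlieBracket (𝓡 n) P.ξ (P.phiApply X) = P.phiApply (mlieBracket (𝓡 n) P.ξ X) := by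
  ext1 x
  have h := hP.h_eq_zero X hX x
  rw [AlmostParacontactStructure.h, smul_eq_zero_iff_right (by norm_num), sub_eq_zero] at h
  exact h

/-- The Reeb field of a K-paracontact structure is Killing. -/
theorem dirDeriv_ξ_pair (hP : P.IsKParacontact g) (hX : IsSmoothField X)
    (hY : IsSmoothField Y) :
    dirDeriv P.ξ (g.pair X Y) x =
      g.pair (mlieBracket (𝓡 n) P.ξ X) Y x + g.pair X (mlieBracket (𝓡 n) P.ξ Y) x := by
  have hξ := P.smooth_ξ
  have hP' := hP.toIsParacontactMetric
  have hφY := P.isSmoothField_phiApply hY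
  have hηX := P.contMDiff_etaApply hX
  have hηY := P.contMDiff_etaApply hY
  rw [hP'.pair_eq hX hY, hP'.pair_eq (hξ.mlieBracket hX) hY, hP'.pair_eq hX (hξ.mlieBracket hY),
    dirDeriv_add (P.contMDiff_dEta hX hφY) (hηX.mul hηY), dirDeriv_mul hηX hηY,
    hP'.dirDeriv_ξ_dEta hX hφY, hP.mlieBracket_ξ_phiApply hY, hP'.dirDeriv_ξ_etaApply hX,
    hP'.dirDeriv_ξ_etaApply hY]
  simp only [Pi.add_apply, Pi.mul_apply]
  ring

/-- If `dF` is a multiple of `η`, the multiple vanishes in dimension greater than one. -/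
theorem dirDeriv_ξ_eq_zero [T2Space M] (hn : 1 < n) (hP : P.IsKParacontact g) {F : M → ℝ}
    (hF : ContMDiff (𝓡 n) 𝓘(ℝ) ∞ F)
    (hdF : ∀ X : Π x : M, TangentSpace (𝓡 n) x, IsSmoothField X →
      dirDeriv X F = dirDeriv P.ξ F * P.etaApply X) (x : M) : dirDeriv P.ξ F x = 0 := by
  by_contra hρ
  have hval (v w : TangentSpace (𝓡 n) x) : g.val x (P.φ x v) w = 0 := by
    obtain ⟨X, hX, rfl⟩ := exists_isSmoothField_eq x v
    obtain ⟨Y, hY, rfl⟩ := exists_isSmoothField_eq x w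
    have hφX := P.isSmoothField_phiApply hX
    have hφY := P.isSmoothField_phiApply hY
    have h0 (Z : Π x : M, TangentSpace (𝓡 n) x) (hZ : IsSmoothField Z) :
        dirDeriv (P.phiApply Z) F = fun _ ↦ 0 := by
      rw [hdF _ (P.isSmoothField_phiApply hZ), P.etaApply_phiApply]
      exact mul_zero _
    -- `F` is constant along `φX` and `φY`, hence along their bracket, so `(ξF) η([φX, φY]) = 0`.
    -- With `ξF ≠ 0` at `x` this makes `dη(φX, φY) = g(φX, Y)` vanish there.
    have h1 := P.dirDeriv_mlieBracket (x := x) hφX hφY hF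
    rw [h0 X hX, h0 Y hY, dirDeriv_const, dirDeriv_const, hdF _ (hφX.mlieBracket hφY),
      sub_zero, Pi.mul_apply, mul_eq_zero, or_iff_right hρ] at h1
    have h2 := hP.contact _ _ hφX hφY x
    rw [hP.toIsParacontactMetric.pair_phiApply_phiApply, dEta, h1, P.etaApply_phiApply,
      P.etaApply_phiApply, dirDeriv_const, dirDeriv_const] at h2
    simp only [zero_mul, sub_zero, zero_div] at h2
    exact h2.symm
  -- Now `φ = 0` at `x`, so `φ² = I - η ⊗ ξ` makes `ξ` span the tangent space.
  have hφ (v : TangentSpace (𝓡 n) x) : P.η x v • P.ξ x = v := by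
    have h := P.φ_sq x v
    rw [g.nondegenerate x _ (hval v), map_zero] at h
    exact (sub_eq_zero.1 h.symm).symm
  have hle : Module.finrank ℝ (TangentSpace (𝓡 n) x) ≤ 1 :=
    finrank_le_one (P.ξ x) fun v ↦ ⟨P.η x v, hφ v⟩
  have hfr : Module.finrank ℝ (TangentSpace (𝓡 n) x) = n := finrank_euclideanSpace_fin (𝕜 := ℝ)
  omega

end IsKParacontact

end AlmostParacontactStructure

/-! ### Consequences of the soliton equation. -/

namespace PseudoRiemannianMetric

variable {P : AlmostParacontactStructure n M} {u δ l : M → ℝ}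

theorem pair_gradient_left (g : PseudoRiemannianMetric n M) :
    g.pair (g.gradient u) X = dirDeriv X u :=
  funext fun _ ↦ g.val_sharp _ _ _

namespace IsAlmostGradientYamabeSoliton

theorem lieDeriv_gradient (hu : g.IsAlmostGradientYamabeSoliton u δ l) (hX : IsSmoothField X)
    (hY : IsSmoothField Y) :
    g.lieDeriv (g.gradient u) X Y x =
      2 * ((g.scalarCurvature x - l x) / δ x) * g.pair X Y x := by
  have h := hu.soliton.soliton X Y hX hY x
  have hδ := hu.soliton.delta_ne_zero x
  field_simp
  linarith

/-- `X (ξ u) = ((r - λ) / δ) η(X) - (φ X) u`. -/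
theorem dirDeriv_dirDeriv_ξ (hP : P.IsKParacontact g)
    (hu : g.IsAlmostGradientYamabeSoliton u δ l) (hX : IsSmoothField X) :
    dirDeriv X (dirDeriv P.ξ u) x =
      (g.scalarCurvature x - l x) / δ x * P.etaApply X x - dirDeriv (P.phiApply X) u x := by
  have hP' := hP.toIsParacontactMetric
  have hD := hu.soliton.smooth_field
  have h1 := hu.lieDeriv_gradient (x := x) P.smooth_ξ hX
  rw [lieDeriv, hP'.pair_ξ_left, hP'.pair_ξ_left] at h1
  -- The Killing identity for `g(∇u, X) = Xu` yields `g([ξ, ∇u], X) = X(ξu)`.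
  have h2 := hP.dirDeriv_ξ_pair (x := x) hD hX
  rw [pair_gradient_left, pair_gradient_left,
    P.dirDeriv_mlieBracket P.smooth_ξ hX hu.smooth_potential,
    mlieBracket_swap, pair, Pi.neg_apply, map_neg] at h2
  change _ = - g.pair (mlieBracket (𝓡 n) (g.gradient u) P.ξ) X x + _ at h2
  -- The contact condition replaces `∇u(η(X)) - η([∇u, X])` in `h1` by `X(ξu) + 2 (φX)u`.
  have h3 := hP.contact _ _ hD hX x
  have h4 : P.etaApply (g.gradient u) = dirDeriv P.ξ u := by
    rw [← hP'.pair_ξ_left, pair_comm, pair_gradient_left]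
  rw [AlmostParacontactStructure.dEta, pair_gradient_left, h4] at h3
  linarith

/-- Besides computing `(r - λ)/δ`, this shows that it is smooth, with no regularity of `δ` assumed.
-/
theorem dirDeriv_ξ_dirDeriv_ξ (hP : P.IsKParacontact g)
    (hu : g.IsAlmostGradientYamabeSoliton u δ l) :
    dirDeriv P.ξ (dirDeriv P.ξ u) = fun x ↦ (g.scalarCurvature x - l x) / δ x := by
  ext x
  have hφ : P.phiApply P.ξ x = 0 := P.φ_ξ x
  rw [hu.dirDeriv_dirDeriv_ξ hP P.smooth_ξ, P.etaApply_ξ]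
  simp [dirDeriv, hφ]

/-- Put `v = ξu`. Then `(φZ)v = η(Z)v - Zu`; applying this to `X` and `[ξ, X]` in `[ξ, φX]v =
ξ((φX)v) - (φX)(ξv)` gives `(φX)(ξv) = η(X) ξv - Xv`, which is `(φX)u`. -/
theorem dirDeriv_phiApply (hP : P.IsKParacontact g)
    (hu : g.IsAlmostGradientYamabeSoliton u δ l) (hX : IsSmoothField X) :
    dirDeriv (P.phiApply X) (dirDeriv P.ξ (dirDeriv P.ξ u)) x = dirDeriv (P.phiApply X) u x := by
  have hξ := P.smooth_ξ
  have hηX := P.contMDiff_etaApply hX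
  have hv := P.contMDiff_dirDeriv hξ hu.smooth_potential
  have hXu := P.contMDiff_dirDeriv hX hu.smooth_potential
  have hφφ (Z : Π x : M, TangentSpace (𝓡 n) x) (hZ : IsSmoothField Z) :
      dirDeriv (P.phiApply Z) (dirDeriv P.ξ u) =
        P.etaApply Z * dirDeriv P.ξ u - dirDeriv Z u := by
    ext x
    rw [hu.dirDeriv_dirDeriv_ξ hP (P.isSmoothField_phiApply hZ), P.etaApply_phiApply]
    simp [dirDeriv, AlmostParacontactStructure.phiApply, AlmostParacontactStructure.etaApply,
      P.φ_sq]
  have h := P.dirDeriv_mlieBracket (x := x) hξ (P.isSmoothField_phiApply hX) hv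
  have hb := P.dirDeriv_mlieBracket (x := x) hξ hX hu.smooth_potential
  rw [hP.mlieBracket_ξ_phiApply hX, hφφ _ (hξ.mlieBracket hX), hφφ _ hX,
    dirDeriv_sub (hηX.mul hv) hXu, dirDeriv_mul hηX hv,
    hP.toIsParacontactMetric.dirDeriv_ξ_etaApply hX, Pi.sub_apply, Pi.mul_apply, hb] at h
  have hXv := hu.dirDeriv_dirDeriv_ξ (x := x) hP hX
  rw [← congrFun (hu.dirDeriv_ξ_dirDeriv_ξ hP) x] at hXv
  linarith

/-- The differential of `(r - λ) / δ - u = ξ (ξ u) - u` is a multiple of `η`. -/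
theorem dirDeriv_sub_potential (hP : P.IsKParacontact g)
    (hu : g.IsAlmostGradientYamabeSoliton u δ l) (hX : IsSmoothField X) :
    dirDeriv X (dirDeriv P.ξ (dirDeriv P.ξ u) - u) =
      dirDeriv P.ξ (dirDeriv P.ξ (dirDeriv P.ξ u) - u) * P.etaApply X := by
  ext x
  have hf := P.contMDiff_dirDeriv P.smooth_ξ
    (P.contMDiff_dirDeriv P.smooth_ξ hu.smooth_potential)
  -- Since `φ²X = X - η(X)ξ`, the vanishing of the differential on `φ(φX)` is exactly the claim.
  have h := dirDeriv_sub (x := x) (X := P.phiApply (P.phiApply X)) hf hu.smooth_potential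
  rw [hu.dirDeriv_phiApply hP (P.isSmoothField_phiApply hX), sub_self] at h
  simp only [dirDeriv, AlmostParacontactStructure.phiApply, P.φ_sq, map_sub, map_smul,
    smul_eq_mul] at h
  simp only [dirDeriv, AlmostParacontactStructure.etaApply, Pi.mul_apply]
  linarith

end IsAlmostGradientYamabeSoliton

end PseudoRiemannianMetric

end Paracontact

theorem mainTheorem5 {n : ℕ} (hn : 1 < n) {M : Type*} [TopologicalSpace M] [T2Space M]
    [SecondCountableTopology M] [ConnectedSpace M] [ChartedSpace (Paracontact.E n) M]
    [IsManifold (𝓡 n) ∞ M]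
    (g : Paracontact.PseudoRiemannianMetric n M)
    (P : Paracontact.AlmostParacontactStructure n M) (hP : P.IsKParacontact g)
    (u δ l : M → ℝ) (hu : g.IsAlmostGradientYamabeSoliton u δ l) :
    ∃ c : ℝ, ∀ x : M, (g.scalarCurvature x - l x) / δ x - u x = c := by
  have hf := P.contMDiff_dirDeriv P.smooth_ξ
    (P.contMDiff_dirDeriv P.smooth_ξ hu.smooth_potential)
  have hF : ContMDiff (𝓡 n) 𝓘(ℝ) ∞
      (Paracontact.dirDeriv P.ξ (Paracontact.dirDeriv P.ξ u) - u) := hf.sub hu.smooth_potential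
  have hdF (X) (hX : Paracontact.IsSmoothField X) := hu.dirDeriv_sub_potential hP hX
  obtain ⟨c, hc⟩ := Paracontact.exists_eq_const_of_mfderiv_eq_zero
    (hF.mdifferentiable (by simp)) fun x ↦ by
      ext v
      obtain ⟨X, hX, rfl⟩ := Paracontact.exists_isSmoothField_eq x v
      have h := congrFun (hdF X hX) x
      rw [Pi.mul_apply, hP.dirDeriv_ξ_eq_zero hn hF hdF x, zero_mul] at h
      exact h
  refine ⟨c, fun x ↦ ?_⟩
  rw [← hc x, ← congrFun (hu.dirDeriv_ξ_dirDeriv_ξ hP) x, Pi.sub_apply]
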